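/- Let $g:[0,\infty)\to[0,1]$ be non-increasing with $0<C:=\int_{\mathbb R^2}g(\|\boldsymbol x\|)\,d\boldsymbol x<\infty$ and $g(x)=o\!\left(\frac1{x^2\log^2x}\right)$ as $x\to\infty$. Let $b\in\mathbb R$ be a constant and, for $\rho>0$ with $\log\rho+b>0$, put $r_\rho=\sqrt{\frac{\log\rho+b}{C\rho}}$. Let $A=[-\frac12,\frac12)^2$ be the unit torus, write $\|\boldsymbol x\|^T=\min\{\|\boldsymbol x+\boldsymbol z\|:\boldsymbol z\in\mathbb Z^2\}$, and define the toroidal distance of $\boldsymbol x_1,\boldsymbol x_2$ to be $\|\boldsymbol x_1-\boldsymbol x_2\|^T$. Let $\mathcal G^T(\mathcal X_\rho,g_\rho)$ be the random graph whose nodes form a Poisson process of density $\rho$ on $A$ and in which, given the nodes, each pair of distinct nodes $\boldsymbol x_1,\boldsymbol x_2$ is directly connected with probability $g\!\left(\|\boldsymbol x_1-\boldsymbol x_2\|^T/r_\rho\right)$, independently of all other pairs. Let $W^T$ be its number of isolated nodes (nodes not connected to any other node). Then, for every $\rho>0$ with $\log\rho+b>0$, $W^T$ is integrable and $$E(W^T)=\rho\,\exp\!\left(-\int_A\rho\,g\!\left(\frac{\|\boldsymbol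 x\|^T}{r_\rho}\right)d\boldsymbol x\right),$$ and $$\lim_{\rho\to\infty}E(W^T)=e^{-b}.$$ -/

import Mathlib

open MeasureTheory ProbabilityTheory Filter Topology Set

namespace TorusRCM

/-- The Euclidean plane. -/
abbrev Plane : Type := EuclideanSpace ℝ (Fin 2)

/-- The unit square `[-1/2, 1/2)²`, the set of points of the unit torus. -/
def square : Set Plane := {x | ∀ i, x i ∈ Ico (-(1 / 2) : ℝ) (1 / 2)}

/-- A vector of the plane with integer coordinates. -/
def latticeVec (z : Fin 2 → ℤ) : Plane := WithLp.toLp 2 fun i => (z i : ℝ)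

/-- The toroidal norm `‖x‖ᵀ = min {‖x + z‖ : z ∈ ℤ²}`; the toroidal distance between `x₁` and `x₂`
is `torusNorm (x₁ - x₂)`. -/
noncomputable def torusNorm (x : Plane) : ℝ := ⨅ z : Fin 2 → ℤ, ‖x + latticeVec z‖

theorem torusNorm_neg (x : Plane) : torusNorm (-x) = torusNorm x := by
  unfold torusNorm
  refine (Equiv.neg (Fin 2 → ℤ)).iInf_congr fun z => ?_
  rw [← norm_neg]
  congr 1
  ext i
  simp [latticeVec]
  ring

/-- The constant `C`, the integral of `g(‖x‖)` over the plane. -/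
noncomputable def connConst (g : ℝ → ℝ) : ℝ := ∫ x : Plane, g ‖x‖

/-- `r_ρ = √((log ρ + b) / (C ρ))`. -/
noncomputable def radius (g : ℝ → ℝ) (b ρ : ℝ) : ℝ :=
  Real.sqrt ((Real.log ρ + b) / (connConst g * ρ))

/-- The uniform distribution on the unit square. -/
noncomputable def squareMeasure : Measure Plane := volume.restrict square

instance : IsProbabilityMeasure squareMeasure := by
  constructor
  have h : square = (WithLp.ofLp : Plane → Fin 2 → ℝ) ⁻¹'
      (Set.univ.pi fun _ : Fin 2 => Ico (-(1 / 2) : ℝ) (1 / 2)) := by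
    ext x
    simp [square, Set.mem_pi]
  rw [squareMeasure, Measure.restrict_apply_univ, h,
    (PiLp.volume_preserving_ofLp (Fin 2)).measure_preimage
      (MeasurableSet.univ_pi fun _ => measurableSet_Ico).nullMeasurableSet, volume_pi_pi]
  norm_num [Real.volume_Ico]

/-- An outcome `(N, X, U)`: the number `N` of nodes, a sequence `X` of positions of which the first
`N` are the nodes, and a mark `U e ∈ [0, 1]` for every unordered pair `e` of node labels. -/
abbrev Outcome : Type := ℕ × (ℕ → Plane) × (Sym2 ℕ → unitInterval)

/-- The law of the outcome: `N` is Poisson with mean `ρ` (the density times the unit area), the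
positions are uniform on the square, the marks are uniform on `[0, 1]`, and all of these are
independent. Thus `X 0, …, X (N - 1)` is a Poisson process of density `ρ` on the square. -/
noncomputable def law (ρ : ℝ) : Measure Outcome :=
  (poissonMeasure ρ.toNNReal).prod
    ((Measure.infinitePi fun _ : ℕ => squareMeasure).prod
      (Measure.infinitePi fun _ : Sym2 ℕ => (volume : Measure unitInterval)))

/-- The random connection model on the torus with connection function `g` and range `r`: given the
nodes, distinct nodes `i`, `j` are joined when their mark is below
`g (‖X i - X j‖ᵀ / r)`, that is, with this probability, independently of all other pairs. -/
def network (g : ℝ → ℝ) (r : ℝ) (ω : Outcome) : SimpleGraph (Fin ω.1) where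
  Adj i j := i ≠ j ∧
    (ω.2.2 s(i.val, j.val) : ℝ) < g (torusNorm (ω.2.1 i - ω.2.1 j) / r)
  symm := ⟨fun i j h => ⟨h.1.symm, by
    rw [Sym2.eq_swap, ← neg_sub, torusNorm_neg]
    exact h.2⟩⟩
  loopless := ⟨fun _ h => h.1 rfl⟩

/-- The number of isolated nodes of the network, as a real random variable. -/
noncomputable def numIsolated (g : ℝ → ℝ) (r : ℝ) (ω : Outcome) : ℝ :=
  ({i | (network g r ω).IsIsolated i}.ncard : ℝ)

end TorusRCM

namespace TorusRCM

/-! Write `h x = g (torusNorm x / r)` and `q = 1 - ∫ h` over the square. Given `n` nodes and their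
positions, node `i` is isolated with probability the product of `1 - h (X i - X j)` over the other
nodes, since these pairs carry distinct independent marks. The torus is homogeneous
(`setIntegral_square_sub`), so integrating out each other node gives a factor `q` wherever `X i`
lies. The conditional mean is thus `n * q ^ (n - 1)`, and the Poisson average of this is `ρ * exp
(-(ρ * (1 - q)))`.

For the limit, the toroidal norm is Euclidean on the square, so rescaling by `r` gives `ρ ∫ h = (log
ρ + b) (1 - τ / C)`, where `τ` is at most the mass of `g ‖x‖` beyond `R = 1 / (4 r)`. The decay of
`g` makes this mass `o(1 / log R)`, while `log ρ + b ≤ 4 log R` eventually. Hence `ρ ∫ h = log ρ + b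
+ o(1)`. -/

theorem measurable_torusNorm : Measurable torusNorm := by
  unfold torusNorm
  exact Measurable.iInf fun z => by fun_prop

theorem torusNorm_nonneg (x : Plane) : 0 ≤ torusNorm x :=
  Real.iInf_nonneg fun _ => norm_nonneg _

theorem torusNorm_add_latticeVec (x : Plane) (w : Fin 2 → ℤ) :
    torusNorm (x + latticeVec w) = torusNorm x := by
  unfold torusNorm
  refine (Equiv.addLeft w).iInf_congr fun z => ?_
  congr 1
  ext i
  simp [latticeVec]
  ring

/-- Coordinate by coordinate: a number in `[-1/2, 1/2)` does not get smaller in absolute value when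
an integer is added. -/
theorem torusNorm_eq_norm {x : Plane} (hx : x ∈ square) : torusNorm x = ‖x‖ := by
  have hb : BddBelow (range fun z : Fin 2 → ℤ => ‖x + latticeVec z‖) :=
    ⟨0, by rintro _ ⟨z, rfl⟩; exact norm_nonneg _⟩
  refine le_antisymm ?_ (le_ciInf fun z => ?_)
  · refine (ciInf_le hb 0).trans_eq ?_
    congr 1
    ext i
    simp [latticeVec]
  · rw [EuclideanSpace.norm_eq, EuclideanSpace.norm_eq]
    refine Real.sqrt_le_sqrt (Finset.sum_le_sum fun i _ => ?_)
    rw [Real.norm_eq_abs, Real.norm_eq_abs, sq_abs, sq_abs]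
    have h := hx i
    simp only [latticeVec, PiLp.add_apply]
    rcases lt_trichotomy (z i) 0 with hz | hz | hz
    · have : (z i : ℝ) ≤ -1 := by exact_mod_cast Int.le_sub_one_of_lt hz
      nlinarith [h.1, h.2]
    · simp [hz]
    · have : (1 : ℝ) ≤ z i := by exact_mod_cast hz
      nlinarith [h.1, h.2]

/-! ### The square as a fundamental domain of the integer lattice -/

theorem measurableSet_square : MeasurableSet square := by
  have : square = ⋂ i : Fin 2, (fun x : Plane => x i) ⁻¹' Ico (-(1 / 2) : ℝ) (1 / 2) := by
    ext x; simp [square]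
  rw [this]
  exact MeasurableSet.iInter fun i => measurableSet_Ico.preimage (by fun_prop)

/-- The inclusion of `ℤ²` in the plane, as a homomorphism. -/
def latticeHom : (Fin 2 → ℤ) →+ Plane where
  toFun := latticeVec
  map_zero' := by ext i; simp [latticeVec]
  map_add' z w := by ext i; simp [latticeVec]

instance : Countable latticeHom.range :=
  (Set.countable_range latticeHom).to_subtype

theorem existsUnique_add_lattice_mem_square (x : Plane) :
    ∃! l : latticeHom.range, (l : Plane) + x ∈ square := by
  have key (t : ℝ) : ∃! m : ℤ, t + m • (1 : ℝ) ∈ Ico (-(1 / 2) : ℝ) (-(1 / 2) + 1) :=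
    existsUnique_add_zsmul_mem_Ico one_pos t _
  choose m hm hu using fun i => key (x i)
  refine ⟨⟨latticeVec m, m, rfl⟩, fun i => ?_, ?_⟩
  · have := hm i
    simp only [zsmul_eq_mul, mul_one] at this
    norm_num at this
    simp only [latticeVec, PiLp.add_apply]
    constructor <;> linarith [this.1, this.2]
  · rintro ⟨_, w, rfl⟩ hw
    refine Subtype.ext (congrArg latticeVec (funext fun i => hu i (w i) ?_))
    have := hw i
    simp only [latticeHom, AddMonoidHom.coe_mk, ZeroHom.coe_mk, latticeVec, PiLp.add_apply] at this
    simp only [zsmul_eq_mul, mul_one]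
    constructor <;> linarith [this.1, this.2]

theorem isAddFundamentalDomain_square :
    IsAddFundamentalDomain latticeHom.range square (volume : Measure Plane) :=
  IsAddFundamentalDomain.mk' measurableSet_square.nullMeasurableSet
    existsUnique_add_lattice_mem_square

theorem isAddFundamentalDomain_sub_square (x : Plane) :
    IsAddFundamentalDomain latticeHom.range ((fun y => x - y) ⁻¹' square)
      (volume : Measure Plane) := by
  refine IsAddFundamentalDomain.mk'
    (measurableSet_square.preimage (by fun_prop)).nullMeasurableSet fun y => ?_
  obtain ⟨l, hl, hu⟩ := existsUnique_add_lattice_mem_square (x - y)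
  refine ⟨-l, ?_, fun k hk => ?_⟩
  · have : x - (-l +ᵥ y) = l + (x - y) := by
      simp [AddSubgroup.vadd_def]; abel
    simpa only [mem_preimage, this] using hl
  · have : x - (k +ᵥ y) = ((-k : latticeHom.range) : Plane) + (x - y) := by
      simp [AddSubgroup.vadd_def]; abel
    simp only [mem_preimage, this] at hk
    rw [← hu (-k) hk, neg_neg]

/-- The substitution `y ↦ x - y` moves the square to a reflected translate, again a fundamental
domain; a periodic function has the same integral over both. -/
theorem setIntegral_square_sub (f : Plane → ℝ)
    (hf : ∀ x w, f (x + latticeVec w) = f x) (x : Plane) :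
    ∫ y in square, f (x - y) = ∫ y in square, f y := by
  have h1 : ∫ y in (fun y => x - y) ⁻¹' ((fun y => x - y) ⁻¹' square), f (x - y)
      = ∫ y in (fun y => x - y) ⁻¹' square, f y :=
    (Measure.measurePreserving_sub_left volume x).setIntegral_preimage_emb
      (MeasurableEquiv.subLeft x).measurableEmbedding f _
  have h2 : (fun y => x - y) ⁻¹' ((fun y => x - y) ⁻¹' square) = square := by
    ext y; simp
  rw [h2] at h1
  rw [h1]
  refine (isAddFundamentalDomain_sub_square x).setIntegral_eq isAddFundamentalDomain_square ?_
  rintro ⟨_, w, rfl⟩ y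
  rw [AddSubgroup.vadd_def, vadd_eq_add, add_comm]
  exact hf y w

/-! ### Isolation probability of a node, given the number of nodes -/

theorem measurable_comp_of_antitoneOn {α : Type*} [MeasurableSpace α] {g : ℝ → ℝ}
    (hg : AntitoneOn g (Ici 0)) {f : α → ℝ} (hf : Measurable f) (hf0 : ∀ x, 0 ≤ f x) :
    Measurable fun x => g (f x) := by
  -- Truncating at 0 makes `g` monotone on the whole line, hence measurable, without changing it
  -- where it is evaluated.
  have h : Antitone fun t => g (max t 0) := fun s t hst =>
    hg (le_max_right s 0) (le_max_right t 0) (max_le_max_right 0 hst)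
  have := h.measurable.comp hf
  simpa only [Function.comp_def, max_eq_left (hf0 _)] using this

theorem infinitePi_map_fin {E : Type*} [MeasurableSpace E] (μ : Measure E)
    [IsProbabilityMeasure μ] (n : ℕ) :
    (Measure.infinitePi fun _ : ℕ => μ).map (fun X (i : Fin n) => X i) =
      Measure.pi fun _ : Fin n => μ := by
  refine (Measure.pi_eq fun s hs => ?_).symm
  rw [Measure.map_apply (by fun_prop) (MeasurableSet.univ_pi hs)]
  have h : (fun (X : ℕ → E) (i : Fin n) => X i) ⁻¹' (univ.pi s) =
      Set.pi (Finset.range n : Set ℕ) fun k => if h : k < n then s ⟨k, h⟩ else univ := by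
    ext X
    simp only [mem_preimage, Set.mem_pi, mem_univ, true_imp_iff, Finset.coe_range, mem_Iio]
    exact ⟨fun H k hk => by rw [dif_pos hk]; exact H ⟨k, hk⟩,
      fun H i => by simpa using H i i.2⟩
  rw [h, Measure.infinitePi_pi]
  · rw [Finset.prod_range]
    simp
  · intro k hk
    simp [Finset.mem_range.1 hk, hs]

theorem integral_prod_sub_succAbove {F : Plane → ℝ} (hF : Measurable F)
    (hF1 : ∀ x, F x ∈ Icc (0 : ℝ) 1) (hper : ∀ x w, F (x + latticeVec w) = F x)
    (n : ℕ) (i : Fin (n + 1)) :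
    ∫ X : Fin (n + 1) → Plane, ∏ j : Fin n, F (X i - X (i.succAbove j))
        ∂(Measure.pi fun _ => squareMeasure) = (∫ y in square, F y) ^ n := by
  rw [← ((measurePreserving_piFinSuccAbove (fun _ => squareMeasure) i).symm).integral_comp']
  simp only [MeasurableEquiv.piFinSuccAbove_symm_apply, Fin.insertNthEquiv, Equiv.coe_fn_mk,
    Fin.insertNth_apply_same, Fin.insertNth_apply_succAbove]
  rw [integral_prod]
  · have h (x : Plane) : ∫ y : Fin n → Plane, ∏ j, F (x - y j)
        ∂(Measure.pi fun _ => squareMeasure) = (∫ y in square, F y) ^ n := by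
      rw [integral_fintype_prod_eq_pow fun y => F (x - y), Fintype.card_fin, squareMeasure,
        setIntegral_square_sub F hper x]
    simp [h]
  · refine Integrable.of_bound (C := 1)
      (Measurable.aestronglyMeasurable (by fun_prop)) (ae_of_all _ fun p => ?_)
    rw [Real.norm_eq_abs, abs_of_nonneg (Finset.prod_nonneg fun j _ => (hF1 _).1)]
    exact Finset.prod_le_one (fun j _ => (hF1 _).1) fun j _ => (hF1 _).2

/-- The event that node `i` is isolated among nodes `0, …, n - 1`, for a general connection
function of the displacement. -/
def isolatedEvent (h : Plane → ℝ) (n : ℕ) (i : Fin n) :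
    Set ((ℕ → Plane) × (Sym2 ℕ → unitInterval)) :=
  {p | ∀ j : Fin n, i ≠ j → h (p.1 i - p.1 j) ≤ p.2 s(i.val, j.val)}

theorem measurableSet_isolatedEvent {h : Plane → ℝ} (hh : Measurable h) (n : ℕ) (i : Fin n) :
    MeasurableSet (isolatedEvent h n i) := by
  simp only [isolatedEvent, ofPred_forall]
  refine MeasurableSet.iInter fun j => MeasurableSet.iInter fun _ => ?_
  exact measurableSet_le (by fun_prop) (by fun_prop)

theorem volume_unitInterval_ge {a : ℝ} (ha : a ∈ Icc (0 : ℝ) 1) :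
    (volume : Measure unitInterval) {u | a ≤ u} = ENNReal.ofReal (1 - a) := by
  exact unitInterval.volume_Ici ⟨a, ha⟩

/-- With the positions frozen, the event constrains the marks of the `n` pairs containing `i`; these
pairs are distinct, so it is a box in the product space. -/
theorem infinitePi_marks_isolated {h : Plane → ℝ} (hh1 : ∀ x, h x ∈ Icc (0 : ℝ) 1)
    (n : ℕ) (i : Fin (n + 1)) (X : ℕ → Plane) :
    (Measure.infinitePi fun _ : Sym2 ℕ => (volume : Measure unitInterval))
        (Prod.mk X ⁻¹' isolatedEvent h (n + 1) i) =
      ENNReal.ofReal (∏ j : Fin n, (1 - h (X i - X (i.succAbove j)))) := by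
  let e : Fin n ↪ Sym2 ℕ := ⟨fun j => s(i.val, (i.succAbove j).val), fun j k hjk =>
    i.succAbove_right_injective (Fin.ext (Sym2.congr_right.1 hjk))⟩
  -- Quantifying over `j` with `q = e j` avoids an inverse of `e`: there is one constraint on the
  -- range of `e` and none off it.
  let t : Sym2 ℕ → Set unitInterval := fun q =>
    {u | ∀ j : Fin n, q = e j → h (X i - X (i.succAbove j)) ≤ u}
  have ht (j : Fin n) : t (e j) = {u : unitInterval | h (X i - X (i.succAbove j)) ≤ u} := by
    ext u
    refine ⟨fun H => H j rfl, fun H k hk => ?_⟩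
    rw [← e.injective hk]
    exact H
  have hs : Prod.mk X ⁻¹' isolatedEvent h (n + 1) i =
      Set.pi ((Finset.univ.map e : Finset (Sym2 ℕ)) : Set (Sym2 ℕ)) t := by
    ext U
    simp only [isolatedEvent, mem_preimage, mem_ofPred_eq, Set.mem_pi, Finset.coe_map,
      Finset.coe_univ, image_univ, forall_mem_range, ht]
    refine ⟨fun H j => H _ (i.succAbove_ne j).symm, fun H j hj => ?_⟩
    obtain ⟨k, rfl⟩ := Fin.exists_succAbove_eq hj.symm
    exact H k
  rw [hs, Measure.infinitePi_pi]
  · rw [Finset.prod_map, ENNReal.ofReal_prod_of_nonneg fun j _ => sub_nonneg.2 (hh1 _).2]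
    exact Finset.prod_congr rfl fun j _ => by rw [ht, volume_unitInterval_ge (hh1 _)]
  · intro q hq
    obtain ⟨j, -, rfl⟩ := Finset.mem_map.1 hq
    rw [ht]
    exact measurableSet_le measurable_const (by fun_prop)

/-- The joint law of the positions and the marks. -/
noncomputable abbrev configLaw : Measure ((ℕ → Plane) × (Sym2 ℕ → unitInterval)) :=
  (Measure.infinitePi fun _ : ℕ => squareMeasure).prod
    (Measure.infinitePi fun _ : Sym2 ℕ => (volume : Measure unitInterval))

theorem measureReal_isolatedEvent {h : Plane → ℝ} (hh : Measurable h)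
    (hh1 : ∀ x, h x ∈ Icc (0 : ℝ) 1) (hper : ∀ x w, h (x + latticeVec w) = h x)
    (n : ℕ) (i : Fin n) :
    configLaw.real (isolatedEvent h n i) = (1 - ∫ y in square, h y) ^ (n - 1) := by
  obtain _ | n := n
  · exact i.elim0
  have hF1 (x : Plane) : 1 - h x ∈ Icc (0 : ℝ) 1 :=
    ⟨sub_nonneg.2 (hh1 x).2, sub_le_self _ (hh1 x).1⟩
  have hG : Measurable fun X : Fin (n + 1) → Plane =>
    ∏ j : Fin n, (1 - h (X i - X (i.succAbove j))) := by fun_prop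
  have hq : ∫ y in square, (1 - h y) = 1 - ∫ y in square, h y := by
    have hi : Integrable h squareMeasure := Integrable.of_bound (C := 1)
      hh.aestronglyMeasurable (ae_of_all _ fun x => by
        rw [Real.norm_eq_abs, abs_of_nonneg (hh1 x).1]; exact (hh1 x).2)
    have := integral_sub (integrable_const (1 : ℝ)) hi
    rw [integral_const, probReal_univ, one_smul] at this
    exact this
  rw [measureReal_def, Measure.prod_apply (measurableSet_isolatedEvent hh _ i)]
  simp only [infinitePi_marks_isolated hh1]
  rw [← integral_eq_lintegral_of_nonneg_ae
    (ae_of_all _ fun X => Finset.prod_nonneg fun j _ => (hF1 _).1)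
    (Measurable.aestronglyMeasurable (by fun_prop))]
  have := integral_map (μ := Measure.infinitePi fun _ : ℕ => squareMeasure)
    (φ := fun X (k : Fin (n + 1)) => X k)
    (Measurable.aemeasurable (by fun_prop)) hG.aestronglyMeasurable
  rw [← this, infinitePi_map_fin,
    integral_prod_sub_succAbove (F := fun x => 1 - h x) (by fun_prop) hF1
      (fun x w => by rw [hper]), hq, Nat.add_sub_cancel]

/-! ### Averaging over the Poisson number of nodes -/

theorem hasSum_poisson_mul_pow (ρ q : ℝ) :
    HasSum (fun n : ℕ => Real.exp (-ρ) * ρ ^ n / n.factorial * (n * q ^ (n - 1)))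
      (ρ * Real.exp (-(ρ * (1 - q)))) := by
  -- The term at 0 vanishes through its factor `n`, so the truncated `n - 1` is harmless there;
  -- after the shift, `n` cancels into the factorial and an exponential series remains.
  rw [← hasSum_nat_add_iff' 1]
  have h := (NormedSpace.expSeries_div_hasSum_exp (ρ * q)).mul_left (ρ * Real.exp (-ρ))
  rw [← Real.exp_eq_exp_ℝ, mul_assoc, ← Real.exp_add] at h
  have e : ρ * Real.exp (-(ρ * (1 - q))) - ∑ i ∈ Finset.range 1,
      Real.exp (-ρ) * ρ ^ i / i.factorial * (i * q ^ (i - 1)) =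
      ρ * Real.exp (-ρ + ρ * q) := by
    rw [Finset.sum_range_one, Nat.cast_zero, zero_mul, mul_zero, sub_zero]
    congr 2
    ring
  rw [e]
  suffices hf : (fun n : ℕ => Real.exp (-ρ) * ρ ^ (n + 1) / (n + 1).factorial *
      ((n + 1 : ℕ) * q ^ (n + 1 - 1))) =
      fun n => ρ * Real.exp (-ρ) * ((ρ * q) ^ n / n.factorial) by
    rw [hf]
    exact h
  ext n
  rw [Nat.add_sub_cancel, Nat.factorial_succ]
  push_cast
  have : (n.factorial : ℝ) ≠ 0 := by positivity
  field_simp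
  ring

theorem numIsolated_eq_sum (g : ℝ → ℝ) (r : ℝ) (n : ℕ)
    (p : (ℕ → Plane) × (Sym2 ℕ → unitInterval)) :
    numIsolated g r (n, p) = ∑ i : Fin n,
      (isolatedEvent (fun x => g (torusNorm x / r)) n i).indicator (fun _ => (1 : ℝ)) p := by
  classical
  have h : {i : Fin n | (network g r (n, p)).IsIsolated i} =
      ((Finset.univ.filter fun i => p ∈ isolatedEvent (fun x => g (torusNorm x / r)) n i :
        Finset (Fin n)) : Set (Fin n)) := by
    ext i
    rw [Finset.mem_coe, Finset.mem_filter]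
    change (∀ w : Fin n, ¬ (network g r (n, p)).Adj i w) ↔ _
    simp [network, isolatedEvent]
  have h' : numIsolated g r (n, p) =
      (({i : Fin n | (network g r (n, p)).IsIsolated i}.ncard : ℕ) : ℝ) := rfl
  rw [h', h, Set.ncard_coe_finset, Finset.card_filter]
  simp [Set.indicator_apply]

theorem integrable_and_integral_numIsolated {g : ℝ → ℝ} {r ρ : ℝ} (hr : 0 ≤ r) (hρ : 0 ≤ ρ)
    (hg_range : ∀ x, 0 ≤ x → g x ∈ Icc (0 : ℝ) 1) (hg_anti : AntitoneOn g (Ici 0)) :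
    Integrable (numIsolated g r) (law ρ) ∧
      ∫ ω, numIsolated g r ω ∂(law ρ) =
        ρ * Real.exp (-∫ x in square, ρ * g (torusNorm x / r)) := by
  set h : Plane → ℝ := fun x => g (torusNorm x / r) with hdef
  have h0 (x : Plane) : 0 ≤ torusNorm x / r := div_nonneg (torusNorm_nonneg x) hr
  have hh : Measurable h :=
    measurable_comp_of_antitoneOn hg_anti (measurable_torusNorm.div_const r) h0
  have hh1 (x : Plane) : h x ∈ Icc (0 : ℝ) 1 := hg_range _ (h0 x)
  have hper (x : Plane) (w : Fin 2 → ℤ) : h (x + latticeVec w) = h x := by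
    simp only [hdef, torusNorm_add_latticeVec]
  set q := 1 - ∫ x in square, h x with hq
  have hmeas : Measurable (numIsolated g r) := by
    refine measurable_from_prod_countable_right fun n => ?_
    simp only [numIsolated_eq_sum]
    exact Finset.measurable_sum _ fun i _ =>
      measurable_const.indicator (measurableSet_isolatedEvent hh n i)
  have hind (n : ℕ) (i : Fin n) : Integrable
      ((isolatedEvent h n i).indicator fun _ => (1 : ℝ)) configLaw :=
    (integrable_const 1).indicator (measurableSet_isolatedEvent hh n i)
  have hint (n : ℕ) : Integrable (fun p => numIsolated g r (n, p)) configLaw := by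
    simp only [numIsolated_eq_sum]
    exact integrable_finsetSum _ fun i _ => hind n i
  have hval (n : ℕ) : ∫ p, numIsolated g r (n, p) ∂configLaw = n * q ^ (n - 1) := by
    simp only [numIsolated_eq_sum]
    rw [integral_finsetSum _ fun i _ => hind n i]
    simp only [integral_indicator_const _ (measurableSet_isolatedEvent hh n _),
      measureReal_isolatedEvent hh hh1 hper]
    simp [hq]
  have hsum := hasSum_poisson_mul_pow ρ q
  have hnorm (ω : Outcome) : ‖numIsolated g r ω‖ = numIsolated g r ω :=
    Real.norm_of_nonneg (Nat.cast_nonneg _)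
  have hcoe : ((ρ.toNNReal : NNReal) : ℝ) = ρ := Real.coe_toNNReal ρ hρ
  have hI : Integrable (numIsolated g r) (law ρ) := by
    refine (integrable_prod_iff hmeas.aestronglyMeasurable).2 ⟨ae_of_all _ hint, ?_⟩
    simp only [hnorm, hval]
    rw [integrable_poissonMeasure_iff, hcoe]
    -- The sign comes from the term being the mean of a count, so no bound on `q` is needed.
    have hpos (n : ℕ) : 0 ≤ n * q ^ (n - 1) := by
      rw [← hval]
      exact integral_nonneg fun _ => Nat.cast_nonneg _
    simpa only [Real.norm_of_nonneg (hpos _)] using hsum.summable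
  refine ⟨hI, ?_⟩
  rw [law, integral_prod _ hI]
  simp only [hval]
  rw [integral_poissonMeasure, hcoe]
  simp only [smul_eq_mul]
  rw [hsum.tsum_eq, integral_const_mul, hq, sub_sub_cancel]

/-! ### Decay of the tail mass -/

theorem tendsto_neg_inv_log_atTop : Tendsto (fun t : ℝ => -(Real.log t)⁻¹) atTop (𝓝 0) := by
  simpa using (tendsto_inv_atTop_zero.comp Real.tendsto_log_atTop).neg

theorem hasDerivAt_neg_inv_log {t : ℝ} (ht : 1 < t) :
    HasDerivAt (fun t : ℝ => -(Real.log t)⁻¹) (1 / (t * Real.log t ^ 2)) t := by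
  have hl := (Real.log_pos ht).ne'
  have := ((Real.hasDerivAt_log (by positivity : t ≠ 0)).inv hl).neg
  refine this.congr_deriv ?_
  field_simp

theorem integrableOn_Ioi_one_div_mul_log_sq {R : ℝ} (hR : 1 < R) :
    IntegrableOn (fun t : ℝ => 1 / (t * Real.log t ^ 2)) (Ioi R) :=
  integrableOn_Ioi_deriv_of_nonneg' (fun _ ht => hasDerivAt_neg_inv_log (hR.trans_le ht))
    (fun t ht => by
      have : 0 < t := by linarith [mem_Ioi.1 ht]
      positivity)
    tendsto_neg_inv_log_atTop

theorem integral_Ioi_one_div_mul_log_sq {R : ℝ} (hR : 1 < R) :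
    ∫ t in Ioi R, 1 / (t * Real.log t ^ 2) = (Real.log R)⁻¹ := by
  rw [integral_Ioi_of_hasDerivAt_of_tendsto'
    (fun _ ht => hasDerivAt_neg_inv_log (hR.trans_le ht))
    (integrableOn_Ioi_one_div_mul_log_sq hR) tendsto_neg_inv_log_atTop]
  simp

/-- The mass of `g ‖x‖` outside the closed ball of radius `R`. -/
noncomputable def tailMass (g : ℝ → ℝ) (R : ℝ) : ℝ :=
  ∫ x : Plane, (Ioi R).indicator g ‖x‖

theorem tailMass_nonneg {g : ℝ → ℝ} (hg0 : ∀ x, 0 ≤ x → 0 ≤ g x) (R : ℝ) : 0 ≤ tailMass g R :=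
  integral_nonneg fun x => by
    by_cases h : ‖x‖ ∈ Ioi R
    · simpa [indicator_of_mem h] using hg0 _ (norm_nonneg x)
    · simp [indicator_of_notMem h]

/-- In polar coordinates the planar Jacobian `t` turns the bound into `δ / (t log² t)`, with
antiderivative `-δ / log t`. -/
theorem tailMass_le {g : ℝ → ℝ} (hg0 : ∀ x, 0 ≤ x → 0 ≤ g x) {R δ : ℝ} (hR : 1 < R)
    (hb : ∀ t, R < t → g t ≤ δ * (1 / (t ^ 2 * Real.log t ^ 2))) :
    tailMass g R ≤ 2 * (volume : Measure Plane).real (Metric.ball 0 1) * δ * (Real.log R)⁻¹ := by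
  rw [tailMass, integral_fun_norm_addHaar volume ((Ioi R).indicator g)]
  have hle : ∫ t in Ioi (0 : ℝ), t * (Ioi R).indicator g t ≤ δ * (Real.log R)⁻¹ := by
    have h : ∀ t, t * (Ioi R).indicator g t = (Ioi R).indicator (fun t => t * g t) t := fun t => by
      by_cases ht : t ∈ Ioi R <;> simp [ht]
    simp only [h]
    rw [setIntegral_indicator measurableSet_Ioi, Ioi_inter_Ioi, sup_of_le_right (by linarith),
      ← integral_Ioi_one_div_mul_log_sq hR, ← integral_const_mul]
    refine integral_mono_of_nonneg ?_ ((integrableOn_Ioi_one_div_mul_log_sq hR).const_mul δ) ?_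
    · filter_upwards [ae_restrict_mem measurableSet_Ioi] with t ht
      have ht0 : 0 ≤ t := by linarith [mem_Ioi.1 ht]
      exact mul_nonneg ht0 (hg0 t ht0)
    · filter_upwards [ae_restrict_mem measurableSet_Ioi] with t ht
      have ht1 : 1 < t := by linarith [mem_Ioi.1 ht]
      have hl := Real.log_pos ht1
      calc t * g t ≤ t * (δ * (1 / (t ^ 2 * Real.log t ^ 2))) :=
            mul_le_mul_of_nonneg_left (hb t ht) (by positivity)
        _ = δ * (1 / (t * Real.log t ^ 2)) := by field_simp
  simp only [finrank_euclideanSpace, Fintype.card_fin, Nat.add_one_sub_one, pow_one, smul_eq_mul,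
    nsmul_eq_mul, Nat.cast_ofNat]
  calc _ ≤ 2 * ((volume : Measure Plane).real (Metric.ball 0 1) * (δ * (Real.log R)⁻¹)) := by gcongr
    _ = _ := by ring

theorem tendsto_tailMass_mul_log {g : ℝ → ℝ} (hg0 : ∀ x, 0 ≤ x → 0 ≤ g x)
    (hg_decay : g =o[atTop] fun x : ℝ => 1 / (x ^ 2 * Real.log x ^ 2)) :
    Tendsto (fun R => tailMass g R * Real.log R) atTop (𝓝 0) := by
  rw [Metric.tendsto_nhds]
  intro ε hε
  set c := 2 * (volume : Measure Plane).real (Metric.ball 0 1)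
  have hc : 0 ≤ c := by positivity
  -- The `+ 1` makes the denominator positive and the final inequality strict.
  set δ := ε / (c + 1) with hδ
  have hδ0 : 0 < δ := by positivity
  obtain ⟨R₀, h₀⟩ := eventually_atTop.1 (hg_decay.def hδ0)
  filter_upwards [eventually_gt_atTop 1, eventually_ge_atTop R₀] with R hR hRR
  have hl := Real.log_pos hR
  have hle := tailMass_le hg0 hR (δ := δ) fun t ht => by
    have := h₀ t (hRR.trans ht.le)
    rw [Real.norm_eq_abs, Real.norm_eq_abs, abs_of_nonneg (a := 1 / _) (by positivity)] at this
    exact (le_abs_self _).trans this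
  rw [Real.dist_eq, sub_zero, abs_of_nonneg (mul_nonneg (tailMass_nonneg hg0 R) hl.le)]
  calc tailMass g R * Real.log R ≤ c * δ * (Real.log R)⁻¹ * Real.log R := by gcongr
    _ = c * δ := by field_simp
    _ < (c + 1) * δ := by nlinarith
    _ = ε := by rw [hδ]; field_simp

/-! ### Asymptotics of the exponent -/

/-- The radius `1/2` would fail strictly, because the half-open square omits `(1/2, 0)`; any smaller
radius serves. -/
theorem quarter_lt_norm {x : Plane} (hx : x ∉ square) : 1 / 4 < ‖x‖ := by
  by_contra! h
  refine hx fun i => ?_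
  have := abs_le.1 ((PiLp.norm_apply_le x i).trans h)
  constructor <;> linarith [this.1, this.2]

theorem setIntegral_square_bounds {g : ℝ → ℝ} {r : ℝ} (hr : 0 < r)
    (hg0 : ∀ x, 0 ≤ x → 0 ≤ g x) (hg_int : Integrable fun x : Plane => g ‖x‖) :
    r ^ 2 * (connConst g - tailMass g (1 / (4 * r))) ≤ ∫ x in square, g (torusNorm x / r) ∧
      ∫ x in square, g (torusNorm x / r) ≤ r ^ 2 * connConst g := by
  have hn (x : Plane) : ‖r⁻¹ • x‖ = ‖x‖ / r := by
    rw [norm_smul, norm_inv, Real.norm_of_nonneg hr.le, inv_mul_eq_div]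
  have hscale (f : ℝ → ℝ) : ∫ x : Plane, f (‖x‖ / r) = r ^ 2 * ∫ x : Plane, f ‖x‖ := by
    have := Measure.integral_comp_inv_smul_of_nonneg (volume : Measure Plane)
      (fun x => f ‖x‖) hr.le
    simpa only [hn, finrank_euclideanSpace, Fintype.card_fin, smul_eq_mul] using this
  have hint : Integrable fun x : Plane => g (‖x‖ / r) := by
    simpa only [hn] using hg_int.comp_smul (inv_ne_zero hr.ne')
  have hsplit := integral_add_compl measurableSet_square hint
  have htor : ∫ x in square, g (torusNorm x / r) = ∫ x in square, g (‖x‖ / r) :=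
    setIntegral_congr_fun measurableSet_square fun x hx => by
      simp only [torusNorm_eq_norm hx]
  rw [hscale] at hsplit
  have hpos (x : Plane) : 0 ≤ g (‖x‖ / r) := hg0 _ (by positivity)
  have hc0 : 0 ≤ ∫ x in squareᶜ, g (‖x‖ / r) := integral_nonneg hpos
  have hc1 : ∫ x in squareᶜ, g (‖x‖ / r) ≤ r ^ 2 * tailMass g (1 / (4 * r)) := by
    rw [tailMass, ← hscale ((Ioi (1 / (4 * r))).indicator g),
      ← integral_indicator measurableSet_square.compl]
    have hI : (fun x : Plane => (Ioi (1 / (4 * r))).indicator g (‖x‖ / r)) =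
        ((fun x : Plane => ‖x‖ / r) ⁻¹' Ioi (1 / (4 * r))).indicator fun x => g (‖x‖ / r) := rfl
    rw [hI]
    refine integral_mono (hint.indicator measurableSet_square.compl)
      (hint.indicator (measurableSet_Ioi.preimage (by fun_prop))) fun x => ?_
    refine indicator_le_indicator_of_subset (fun x hx => ?_) hpos x
    rw [mem_preimage, mem_Ioi, lt_div_iff₀ hr]
    calc 1 / (4 * r) * r = 1 / 4 := by field_simp
      _ < ‖x‖ := quarter_lt_norm hx
  rw [htor, connConst]
  constructor <;> linarith

/-- The logarithm on the right is `(1/2) log ρ` up to `O(log log ρ)`, so the factor 4 leaves room to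
spare. -/
theorem log_add_le_four_mul_log {C b : ℝ} (hC : 0 < C) :
    ∀ᶠ ρ : ℝ in atTop, Real.log ρ + b ≤
      4 * Real.log (1 / (4 * Real.sqrt ((Real.log ρ + b) / (C * ρ)))) := by
  have hL : Tendsto (fun ρ : ℝ => Real.log ρ + b) atTop atTop :=
    tendsto_atTop_add_const_right _ b Real.tendsto_log_atTop
  have hlog : ∀ᶠ L : ℝ in atTop, Real.log L ≤ 1 / 4 * L := by
    filter_upwards [Real.isLittleO_log_id_atTop.def (by norm_num : (0 : ℝ) < 1 / 4),
      eventually_ge_atTop 0] with L h h0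
    rw [id, Real.norm_of_nonneg h0] at h
    exact (le_abs_self _).trans h
  filter_upwards [hL.eventually hlog, hL.eventually_gt_atTop 0, eventually_gt_atTop 0,
    -- With `L = log ρ + b` and `log L ≤ L / 4`, the claim reduces to this lower bound on `L`.
    hL.eventually_ge_atTop (8 * (Real.log 4 + b / 2 - Real.log C / 2))] with ρ h1 h2 h3 h4
  have hs : 0 < Real.sqrt ((Real.log ρ + b) / (C * ρ)) := Real.sqrt_pos.2 (by positivity)
  rw [one_div, Real.log_inv, Real.log_mul (by norm_num) hs.ne', Real.log_sqrt (by positivity),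
    Real.log_div h2.ne' (by positivity), Real.log_mul hC.ne' h3.ne']
  linarith

theorem tendsto_expectation_formula {g : ℝ → ℝ} {b : ℝ}
    (hg0 : ∀ x, 0 ≤ x → 0 ≤ g x) (hg_int : Integrable fun x : Plane => g ‖x‖)
    (hg_pos : 0 < ∫ x : Plane, g ‖x‖)
    (hg_decay : g =o[atTop] fun x : ℝ => 1 / (x ^ 2 * Real.log x ^ 2)) :
    Tendsto (fun ρ : ℝ =>
        ρ * Real.exp (-∫ x in square, ρ * g (torusNorm x / radius g b ρ)))
      atTop (𝓝 (Real.exp (-b))) := by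
  have hC : 0 < connConst g := hg_pos
  have hL : Tendsto (fun ρ : ℝ => Real.log ρ + b) atTop atTop :=
    tendsto_atTop_add_const_right _ b Real.tendsto_log_atTop
  have hlogR : ∀ᶠ ρ : ℝ in atTop,
      Real.log ρ + b ≤ 4 * Real.log (1 / (4 * radius g b ρ)) := log_add_le_four_mul_log hC
  have hrpos : ∀ᶠ ρ : ℝ in atTop, 0 < radius g b ρ := by
    filter_upwards [hL.eventually_gt_atTop 0, eventually_gt_atTop 0] with ρ h1 h2
    exact Real.sqrt_pos.2 (by positivity)
  have hR : Tendsto (fun ρ => 1 / (4 * radius g b ρ)) atTop atTop := by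
    -- From `(log ρ + b) / 4 ≤ log R ≤ R - 1`.
    refine tendsto_atTop_mono' _ ?_ (hL.atTop_div_const (by norm_num : (0 : ℝ) < 4))
    filter_upwards [hlogR, hrpos] with ρ h1 h2
    linarith [Real.log_le_sub_one_of_pos (by positivity : 0 < 1 / (4 * radius g b ρ))]
  have hT : Tendsto (fun ρ => 4 / connConst g * (tailMass g (1 / (4 * radius g b ρ)) *
      Real.log (1 / (4 * radius g b ρ)))) atTop (𝓝 0) := by
    simpa using ((tendsto_tailMass_mul_log hg0 hg_decay).comp hR).const_mul (4 / connConst g)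
  have hD : Tendsto (fun ρ => Real.log ρ + b -
      ∫ x in square, ρ * g (torusNorm x / radius g b ρ)) atTop (𝓝 0) := by
    -- The difference is nonnegative because the whole plane contributes exactly `log ρ + b`, and
    -- its excess over the square is bounded by the tail.
    refine tendsto_of_tendsto_of_tendsto_of_le_of_le' tendsto_const_nhds hT ?_ ?_
    all_goals
      filter_upwards [hL.eventually_gt_atTop 0, eventually_gt_atTop 0, hlogR, hrpos]
        with ρ h1 h2 h3 h4
      obtain ⟨hlo, hhi⟩ := setIntegral_square_bounds h4 hg0 hg_int
      have hr2 : ρ * radius g b ρ ^ 2 = (Real.log ρ + b) / connConst g := by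
        rw [radius, Real.sq_sqrt (by positivity)]
        field_simp
      rw [integral_const_mul]
    · have := mul_le_mul_of_nonneg_left hhi h2.le
      rw [← mul_assoc, hr2, div_mul_cancel₀ _ hC.ne'] at this
      linarith
    · have := mul_le_mul_of_nonneg_left hlo h2.le
      rw [← mul_assoc, hr2, mul_sub, div_mul_cancel₀ _ hC.ne'] at this
      have ht := tailMass_nonneg hg0 (1 / (4 * radius g b ρ))
      calc _ ≤ (Real.log ρ + b) / connConst g * tailMass g (1 / (4 * radius g b ρ)) := by linarith
        _ ≤ 4 * Real.log (1 / (4 * radius g b ρ)) / connConst g *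
            tailMass g (1 / (4 * radius g b ρ)) := by gcongr
        _ = _ := by ring
  have hE := (Real.continuous_exp.tendsto _).comp (hD.sub_const b)
  rw [zero_sub] at hE
  refine hE.congr' ?_
  filter_upwards [eventually_gt_atTop 0] with ρ hρ
  rw [Function.comp_apply, sub_right_comm, add_sub_cancel_right, sub_eq_add_neg, Real.exp_add,
    Real.exp_log hρ]

end TorusRCM

theorem mainTheorem7 (g : ℝ → ℝ) (b : ℝ)
    (hg_range : ∀ x, 0 ≤ x → g x ∈ Set.Icc (0 : ℝ) 1)
    (hg_anti : AntitoneOn g (Set.Ici 0))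
    (hg_int : Integrable fun x : TorusRCM.Plane => g ‖x‖)
    (hg_pos : 0 < ∫ x : TorusRCM.Plane, g ‖x‖)
    (hg_decay : g =o[atTop] fun x : ℝ => 1 / (x ^ 2 * Real.log x ^ 2)) :
    (∀ ρ : ℝ, 0 < ρ → 0 < Real.log ρ + b →
      Integrable (TorusRCM.numIsolated g (TorusRCM.radius g b ρ)) (TorusRCM.law ρ) ∧
      ∫ ω, TorusRCM.numIsolated g (TorusRCM.radius g b ρ) ω ∂(TorusRCM.law ρ) =
        ρ * Real.exp (-∫ x in TorusRCM.square,
          ρ * g (TorusRCM.torusNorm x / TorusRCM.radius g b ρ))) ∧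
    Tendsto (fun ρ : ℝ =>
        ∫ ω, TorusRCM.numIsolated g (TorusRCM.radius g b ρ) ω ∂(TorusRCM.law ρ))
      atTop (𝓝 (Real.exp (-b))) := by
  have hexact (ρ : ℝ) (hρ : 0 < ρ) := TorusRCM.integrable_and_integral_numIsolated
    (r := TorusRCM.radius g b ρ) (Real.sqrt_nonneg _) hρ.le hg_range hg_anti
  refine ⟨fun ρ hρ _ => hexact ρ hρ, ?_⟩
  refine (TorusRCM.tendsto_expectation_formula (fun x hx => (hg_range x hx).1)
    hg_int hg_pos hg_decay).congr' ?_
  filter_upwards [eventually_gt_atTop 0] with ρ hρ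
  exact (hexact ρ hρ).2.symm
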